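/- Let $\Lambda$ be an artin algebra (that is, an algebra over a commutative artinian ring $R$ which is finitely generated as an $R$-module), and let $\Gamma=\begin{pmatrix}\Lambda&0\\ \Lambda&\Lambda\end{pmatrix}$. A (left) $\Gamma$-module $X$ is identified with the triple $(X_1,X_2,t)$, where $X_1=e_{11}X$ and $X_2=e_{22}X$ are $\Lambda$-modules (via the scalar matrices) and $t:X_1\to X_2$ is the $\Lambda$-linear map given by multiplication by the matrix unit $e_{21}$. Maps of $\Gamma$-modules are then pairs of $\Lambda$-linear maps commuting with the structure maps. Put $X_0=\ker t$ and $X_3=\operatorname{coker} t$; a map $(\varphi_1\ \varphi_2)$ of $\Gamma$-modules induces a map $\varphi_0$ of kernels and a map $\varphi_3$ of cokernels. A splittable epimorphism (resp. monomorphism) is a map with a right (resp. left) inverse. A short exact sequence $0\to N\xrightarrow{j}E\xrightarrow{p}M\to 0$ of finitely generated $\Gamma$-modules is almost split if: $p$ is not a splittable epimorphism and every map $X\to M$ with $X$ finitely generated that is not a splittable epimorphism factors through $p$; and $j$ is not a splittable monomorphism and every map $N\to X$ with $X$ finitely generated that is not a splittable monomorphism factors through $j$. **Theorem.** Let $$0\to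 (N_1,N_2,g)\xrightarrow{(j_1\ j_2)}(E_1,E_2,h)\xrightarrow{(p_1\ p_2)}(M_1,M_2,f)\to 0$$ be an almost split sequence of finitely generated $\Gamma$-modules, and assume that each of the $\Lambda$-linear maps $g$ and $f$ is neither a splittable epimorphism nor a splittable monomorphism. Then the induced map of kernels $p_0:E_0\to M_0$ is an epimorphism, the induced map of cokernels $j_3:N_3\to E_3$ is a monomorphism, and for each $i=0,1,2,3$ the sequence $$0\to N_i\xrightarrow{j_i}E_i\xrightarrow{p_i}M_i\to 0$$ is exact and splits. In particular, the given sequence belongs to the relative exact structure $\mathcal S$, the class of short exact sequences of $\Gamma$-modules for which the sequences above with $i=0,1,2$ are split exact. -/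

import Mathlib

universe u v w

namespace ARTri

/-! ### Split and almost split maps of modules -/

section General

variable {S : Type u} [Ring S]

/-- A splittable epimorphism: a linear map with a right inverse. -/
def IsSplittableEpi {X : Type v} {Y : Type w} [AddCommGroup X] [Module S X] [AddCommGroup Y]
    [Module S Y] (p : X →ₗ[S] Y) : Prop :=
  ∃ s : Y →ₗ[S] X, p ∘ₗ s = LinearMap.id

/-- A splittable monomorphism: a linear map with a left inverse. -/
def IsSplittableMono {X : Type v} {Y : Type w} [AddCommGroup X] [Module S X] [AddCommGroup Y]
    [Module S Y] (j : X →ₗ[S] Y) : Prop :=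
  ∃ r : Y →ₗ[S] X, r ∘ₗ j = LinearMap.id

variable {A B C : Type v} [AddCommGroup A] [Module S A] [AddCommGroup B] [Module S B]
  [AddCommGroup C] [Module S C]

/-- `0 → A → B → C → 0` is exact. -/
structure IsShortExact (j : A →ₗ[S] B) (p : B →ₗ[S] C) : Prop where
  injective : Function.Injective j
  exact : Function.Exact j p
  surjective : Function.Surjective p

/-- `0 → A → B → C → 0` is exact and splits. -/
structure IsSplitShortExact (j : A →ₗ[S] B) (p : B →ₗ[S] C) : Prop
    extends IsShortExact j p where
  split : IsSplittableEpi p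

/-- `p` is right almost split in the category of finitely generated `S`-modules. -/
structure IsRightAlmostSplit (p : B →ₗ[S] C) : Prop where
  not_split : ¬ IsSplittableEpi p
  factors : ∀ (X : Type v) [AddCommGroup X] [Module S X] [Module.Finite S X] (q : X →ₗ[S] C),
    ¬ IsSplittableEpi q → ∃ t : X →ₗ[S] B, p ∘ₗ t = q

/-- `j` is left almost split in the category of finitely generated `S`-modules. -/
structure IsLeftAlmostSplit (j : A →ₗ[S] B) : Prop where
  not_split : ¬ IsSplittableMono j
  factors : ∀ (X : Type v) [AddCommGroup X] [Module S X] [Module.Finite S X] (q : A →ₗ[S] X),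
    ¬ IsSplittableMono q → ∃ t : B →ₗ[S] X, t ∘ₗ j = q

/-- `0 → A → B → C → 0` is an almost split sequence of finitely generated `S`-modules. -/
structure IsAlmostSplitSequence (j : A →ₗ[S] B) (p : B →ₗ[S] C) : Prop
    extends IsShortExact j p where
  finite_left : Module.Finite S A
  finite_middle : Module.Finite S B
  finite_right : Module.Finite S C
  left_almost_split : IsLeftAlmostSplit j
  right_almost_split : IsRightAlmostSplit p

variable {A' B' : Type v} [AddCommGroup A'] [Module S A'] [AddCommGroup B'] [Module S B']

/-- The map of kernels induced by a commutative square. -/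
def kerMap (a : A →ₗ[S] A') (b : B →ₗ[S] B') (x : A →ₗ[S] B) (y : A' →ₗ[S] B')
    (comm : y ∘ₗ a = b ∘ₗ x) : LinearMap.ker x →ₗ[S] LinearMap.ker y :=
  a.restrict (fun m hm => by
    have h := LinearMap.congr_fun comm m
    simp only [LinearMap.comp_apply] at h
    rw [LinearMap.mem_ker] at hm ⊢
    rw [h, hm, map_zero])

/-- The map of cokernels induced by a commutative square. -/
def cokerMap (a : A →ₗ[S] A') (b : B →ₗ[S] B') (x : A →ₗ[S] B) (y : A' →ₗ[S] B')
    (comm : y ∘ₗ a = b ∘ₗ x) : (B ⧸ LinearMap.range x) →ₗ[S] (B' ⧸ LinearMap.range y) :=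
  Submodule.mapQ _ _ b (by
    rintro _ ⟨m, rfl⟩
    exact ⟨a m, LinearMap.congr_fun comm m⟩)

end General

/-! ### The ring of lower triangular matrices and its modules -/

section Triangular

variable (Λ : Type u) [Ring Λ]

/-- The ring of `2 × 2` matrices over `Λ` whose upper right entry is zero. -/
def triangularSubring : Subring (Matrix (Fin 2) (Fin 2) Λ) where
  carrier := {x | x 0 1 = 0}
  mul_mem' := by
    intro x y hx hy
    simp only [Set.mem_ofPred_eq] at hx hy ⊢
    simp [Matrix.mul_apply, Fin.sum_univ_two, hx, hy]
  one_mem' := by simp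
  add_mem' := by
    intro x y hx hy
    simp only [Set.mem_ofPred_eq] at hx hy ⊢
    simp [hx, hy]
  zero_mem' := by simp
  neg_mem' := by
    intro x hx
    simp only [Set.mem_ofPred_eq] at hx ⊢
    simp [hx]

/-- The triangular matrix ring with rows `(Λ 0)` and `(Λ Λ)`. -/
abbrev TriangularRing : Type u := triangularSubring Λ

/-- The diagonal matrix units. -/
def vertexIdem (i : Fin 2) : TriangularRing Λ :=
  ⟨Matrix.single i i 1, by
    change Matrix.single i i (1 : Λ) 0 1 = 0
    fin_cases i <;> simp [Matrix.single_apply]⟩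

/-- The matrix unit in the lower left corner. -/
def arrowElem : TriangularRing Λ :=
  ⟨Matrix.single 1 0 1, by
    change Matrix.single 1 0 (1 : Λ) 0 1 = 0
    simp⟩

/-- The embedding of `Λ` as scalar matrices. -/
def scalarEmb : Λ →+* TriangularRing Λ :=
  (Matrix.scalar (Fin 2)).codRestrict (triangularSubring Λ) (fun a => by
    change Matrix.scalar (Fin 2) a 0 1 = 0
    simp)

variable {Λ}

theorem vertexIdem_mul_scalarEmb (i : Fin 2) (a : Λ) :
    vertexIdem Λ i * scalarEmb Λ a = scalarEmb Λ a * vertexIdem Λ i := by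
  apply Subtype.ext
  change Matrix.single i i (1 : Λ) * Matrix.scalar (Fin 2) a
    = Matrix.scalar (Fin 2) a * Matrix.single i i (1 : Λ)
  ext k l
  simp [Matrix.single_apply]

theorem arrowElem_mul_scalarEmb (a : Λ) :
    arrowElem Λ * scalarEmb Λ a = scalarEmb Λ a * arrowElem Λ := by
  apply Subtype.ext
  change Matrix.single 1 0 (1 : Λ) * Matrix.scalar (Fin 2) a
    = Matrix.scalar (Fin 2) a * Matrix.single 1 0 (1 : Λ)
  ext k l
  simp [Matrix.single_apply]

theorem vertexIdem_one_mul_arrowElem : vertexIdem Λ 1 * arrowElem Λ = arrowElem Λ := by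
  apply Subtype.ext
  change Matrix.single 1 1 (1 : Λ) * Matrix.single 1 0 (1 : Λ) = Matrix.single 1 0 (1 : Λ)
  simp

variable (Λ)

/-- The additive subgroup `eᵢ M` of a module `M` over the triangular matrix ring. -/
def vertexSubgroup (M : Type v) [AddCommGroup M] [Module (TriangularRing Λ) M] (i : Fin 2) :
    AddSubgroup M where
  carrier := {m | vertexIdem Λ i • m = m}
  add_mem' := by
    intro x y hx hy
    simp only [Set.mem_ofPred_eq] at hx hy ⊢
    rw [smul_add, hx, hy]
  zero_mem' := by simp
  neg_mem' := by
    intro x hx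
    simp only [Set.mem_ofPred_eq] at hx ⊢
    rw [smul_neg, hx]

/-- The components of the triple `(M₁, M₂, f)` attached to a module `M` over the triangular
matrix ring: `Component Λ M 0` is `M₁ = e₁ M` and `Component Λ M 1` is `M₂ = e₂ M`. -/
def Component (M : Type v) [AddCommGroup M] [Module (TriangularRing Λ) M] (i : Fin 2) : Type v :=
  vertexSubgroup Λ M i

instance (M : Type v) [AddCommGroup M] [Module (TriangularRing Λ) M] (i : Fin 2) :
    AddCommGroup (Component Λ M i) :=
  inferInstanceAs (AddCommGroup (vertexSubgroup Λ M i))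

/-- `Λ` acts on the components through scalar matrices. -/
instance (M : Type v) [AddCommGroup M] [Module (TriangularRing Λ) M] (i : Fin 2) :
    Module Λ (Component Λ M i) where
  smul a m := ⟨scalarEmb Λ a • m.1, by
    have hm : vertexIdem Λ i • m.1 = m.1 := m.2
    change vertexIdem Λ i • scalarEmb Λ a • m.1 = scalarEmb Λ a • m.1
    rw [← mul_smul, vertexIdem_mul_scalarEmb, mul_smul, hm]⟩
  one_smul m := Subtype.ext (by
    change scalarEmb Λ 1 • m.1 = m.1
    rw [map_one, one_smul])
  mul_smul a b m := Subtype.ext (by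
    change scalarEmb Λ (a * b) • m.1 = scalarEmb Λ a • scalarEmb Λ b • m.1
    rw [map_mul, mul_smul])
  smul_zero a := Subtype.ext (by
    change scalarEmb Λ a • (0 : M) = 0
    rw [smul_zero])
  smul_add a x y := Subtype.ext (by
    change scalarEmb Λ a • (x.1 + y.1) = scalarEmb Λ a • x.1 + scalarEmb Λ a • y.1
    rw [smul_add])
  add_smul a b m := Subtype.ext (by
    change scalarEmb Λ (a + b) • m.1 = scalarEmb Λ a • m.1 + scalarEmb Λ b • m.1
    rw [map_add, add_smul])
  zero_smul m := Subtype.ext (by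
    change scalarEmb Λ 0 • m.1 = 0
    rw [map_zero, zero_smul])

/-- The map `f : M₁ → M₂` of the triple `(M₁, M₂, f)`: multiplication by the lower left
matrix unit. -/
def structureMap (M : Type v) [AddCommGroup M] [Module (TriangularRing Λ) M] :
    Component Λ M 0 →ₗ[Λ] Component Λ M 1 where
  toFun m := ⟨arrowElem Λ • m.1, by
    change vertexIdem Λ 1 • arrowElem Λ • m.1 = arrowElem Λ • m.1
    rw [← mul_smul, vertexIdem_one_mul_arrowElem]⟩
  map_add' x y := Subtype.ext (smul_add (arrowElem Λ) x.1 y.1)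
  map_smul' a m := Subtype.ext (by
    change arrowElem Λ • scalarEmb Λ a • m.1 = scalarEmb Λ a • arrowElem Λ • m.1
    rw [← mul_smul, arrowElem_mul_scalarEmb, mul_smul])

variable {N E M : Type v} [AddCommGroup N] [Module (TriangularRing Λ) N]
  [AddCommGroup E] [Module (TriangularRing Λ) E] [AddCommGroup M] [Module (TriangularRing Λ) M]

/-- The components `(φ₁, φ₂)` of a map `φ` of modules over the triangular matrix ring. -/
def componentMap (φ : N →ₗ[TriangularRing Λ] E) (i : Fin 2) :
    Component Λ N i →ₗ[Λ] Component Λ E i where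
  toFun m := ⟨φ m.1, by
    have hm : vertexIdem Λ i • m.1 = m.1 := m.2
    change vertexIdem Λ i • φ m.1 = φ m.1
    rw [← map_smul, hm]⟩
  map_add' x y := Subtype.ext (map_add φ x.1 y.1)
  map_smul' a m := Subtype.ext (map_smul φ (scalarEmb Λ a) m.1)

theorem structureMap_comp_componentMap (φ : N →ₗ[TriangularRing Λ] E) :
    structureMap Λ E ∘ₗ componentMap Λ φ 0 = componentMap Λ φ 1 ∘ₗ structureMap Λ N :=
  LinearMap.ext (fun m => Subtype.ext (map_smul φ (arrowElem Λ) m.1).symm)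

/-- The map `φ₀` between the kernels of the structure maps induced by `φ`. -/
def kernelMap (φ : N →ₗ[TriangularRing Λ] E) :
    LinearMap.ker (structureMap Λ N) →ₗ[Λ] LinearMap.ker (structureMap Λ E) :=
  kerMap (componentMap Λ φ 0) (componentMap Λ φ 1) _ _ (structureMap_comp_componentMap Λ φ)

/-- The map `φ₃` between the cokernels of the structure maps induced by `φ`. -/
def cokernelMap (φ : N →ₗ[TriangularRing Λ] E) :
    (Component Λ N 1 ⧸ LinearMap.range (structureMap Λ N)) →ₗ[Λ]
      (Component Λ E 1 ⧸ LinearMap.range (structureMap Λ E)) :=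
  cokerMap (componentMap Λ φ 0) (componentMap Λ φ 1) _ _ (structureMap_comp_componentMap Λ φ)

/-- The relative exact structure `𝒮`: the short exact sequences `0 → N → E → M → 0` of modules
over the triangular matrix ring for which the sequences of the first components, of the second
components and of the kernels of the structure maps are split exact. -/
structure IsRelativelyExact (j : N →ₗ[TriangularRing Λ] E) (p : E →ₗ[TriangularRing Λ] M) : Prop
    extends IsShortExact j p where
  split_kernel : IsSplitShortExact (kernelMap Λ j) (kernelMap Λ p)
  split_fst : IsSplitShortExact (componentMap Λ j 0) (componentMap Λ p 0)
  split_snd : IsSplitShortExact (componentMap Λ j 1) (componentMap Λ p 1)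

end Triangular

end ARTri

namespace ARTri

/-! ### Modules over the triangular ring in coordinates. -/

section Modules

variable {Λ : Type u} [Ring Λ]

/-! Each splitting comes from testing the almost split property against one well-chosen triple. Maps
into `M`: a factorization through `p` of `(M₁, M₁, id) → M` given by `(id, f)`, of `(0, M₂, 0) → M`,
and of `(ker f, 0, 0) → M` yields a section of `p₁`, of `p₂` and of `p₀` respectively. The first
test map is not a splittable epimorphism, because a section of it has a second component splitting
`f`. A section of the second forces `M₁ = 0`, making `f` a splittable monomorphism; a section of the
third forces `M₂ = 0`, making `f` a splittable epimorphism. Map out of `N`: extending `N → (0, coker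
g, 0)` along `j` yields a retraction of `j₃`. A retraction of the test map would force `N₁ = 0`,
making `g` a splittable monomorphism. Exactness is automatic at `i = 1, 2`. For kernels only
surjectivity of `p₀` is in doubt, and for cokernels only injectivity of `j₃`; both follow from the
splittings. The test triples must be finitely generated: `finite_component` and the finiteness
instance on `Triple` ensure this, with `Λ` noetherian for `ker f`. -/

theorem vertexIdem_zero_mul (x : TriangularRing Λ) :
    vertexIdem Λ 0 * x = scalarEmb Λ (x.1 0 0) * vertexIdem Λ 0 := by
  apply Subtype.ext
  have hx : x.1 0 1 = 0 := x.2
  change Matrix.single 0 0 (1 : Λ) * x.1 = Matrix.scalar (Fin 2) (x.1 0 0) * Matrix.single 0 0 1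
  ext k l
  fin_cases k <;> fin_cases l <;> simp [Matrix.mul_apply, Matrix.single_apply, hx]

theorem vertexIdem_one_mul (x : TriangularRing Λ) :
    vertexIdem Λ 1 * x =
      scalarEmb Λ (x.1 1 0) * arrowElem Λ + scalarEmb Λ (x.1 1 1) * vertexIdem Λ 1 := by
  apply Subtype.ext
  change Matrix.single 1 1 (1 : Λ) * x.1 = Matrix.scalar (Fin 2) (x.1 1 0) * Matrix.single 1 0 1
    + Matrix.scalar (Fin 2) (x.1 1 1) * Matrix.single 1 1 1
  ext k l
  fin_cases k <;> fin_cases l <;> simp [Matrix.mul_apply, Matrix.single_apply]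

theorem arrowElem_mul_vertexIdem_zero : arrowElem Λ * vertexIdem Λ 0 = arrowElem Λ := by
  apply Subtype.ext
  change Matrix.single 1 0 (1 : Λ) * Matrix.single 0 0 1 = Matrix.single 1 0 1
  simp

theorem vertexIdem_zero_add_one : vertexIdem Λ 0 + vertexIdem Λ 1 = 1 := by
  apply Subtype.ext
  change Matrix.single 0 0 (1 : Λ) + Matrix.single 1 1 1 = 1
  ext k l
  fin_cases k <;> fin_cases l <;> simp

theorem vertexIdem_mul_self (i : Fin 2) : vertexIdem Λ i * vertexIdem Λ i = vertexIdem Λ i := by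
  apply Subtype.ext
  change Matrix.single i i (1 : Λ) * Matrix.single i i 1 = Matrix.single i i 1
  simp

variable (Λ)
variable {X : Type v} [AddCommGroup X] [Module (TriangularRing Λ) X]

/-- Multiplication by a diagonal matrix unit, as a map to the component. -/
def vertexProj (i : Fin 2) : X →+ Component Λ X i where
  toFun m := ⟨vertexIdem Λ i • m, by
    change vertexIdem Λ i • vertexIdem Λ i • m = vertexIdem Λ i • m
    rw [← mul_smul, vertexIdem_mul_self]⟩
  map_zero' := Subtype.ext (smul_zero _)
  map_add' x y := Subtype.ext (smul_add _ x y)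

variable {Λ}

theorem vertexProj_coe (i : Fin 2) (m : Component Λ X i) : vertexProj Λ i m.1 = m :=
  Subtype.ext m.2

theorem coe_vertexProj_add (m : X) : (vertexProj Λ 0 m).1 + (vertexProj Λ 1 m).1 = m := by
  change vertexIdem Λ 0 • m + vertexIdem Λ 1 • m = m
  rw [← add_smul, vertexIdem_zero_add_one, one_smul]

theorem vertexProj_zero_add (y : Component Λ X 0) (z : Component Λ X 1) :
    vertexProj Λ 0 (y.1 + z.1) = y := by
  -- Since `z = e₁z + e₂z` and `e₂z = z`, the term `e₁z` vanishes.
  have hz : vertexIdem Λ 0 • z.1 = 0 := by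
    have h := coe_vertexProj_add (Λ := Λ) z.1
    rw [vertexProj_coe 1 z] at h
    exact add_eq_right.mp h
  rw [map_add, vertexProj_coe 0 y]
  exact add_eq_left.mpr (Subtype.ext hz)

theorem vertexProj_one_add (y : Component Λ X 0) (z : Component Λ X 1) :
    vertexProj Λ 1 (y.1 + z.1) = z := by
  have hy : vertexIdem Λ 1 • y.1 = 0 := by
    have h := coe_vertexProj_add (Λ := Λ) y.1
    rw [vertexProj_coe 0 y] at h
    exact add_eq_left.mp h
  rw [map_add, vertexProj_coe 1 z]
  exact add_eq_right.mpr (Subtype.ext hy)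

theorem vertexProj_zero_smul (x : TriangularRing Λ) (m : X) :
    vertexProj Λ 0 (x • m) = x.1 0 0 • vertexProj Λ 0 m := by
  apply Subtype.ext
  change vertexIdem Λ 0 • x • m = scalarEmb Λ (x.1 0 0) • vertexIdem Λ 0 • m
  rw [← mul_smul, ← mul_smul, vertexIdem_zero_mul]

theorem vertexProj_one_smul (x : TriangularRing Λ) (m : X) :
    vertexProj Λ 1 (x • m) =
      x.1 1 0 • structureMap Λ X (vertexProj Λ 0 m) + x.1 1 1 • vertexProj Λ 1 m := by
  apply Subtype.ext
  change vertexIdem Λ 1 • x • m = scalarEmb Λ (x.1 1 0) • arrowElem Λ • vertexIdem Λ 0 • m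
    + scalarEmb Λ (x.1 1 1) • vertexIdem Λ 1 • m
  rw [← mul_smul, ← mul_smul (arrowElem Λ), arrowElem_mul_vertexIdem_zero, ← mul_smul,
    ← mul_smul, ← add_smul, vertexIdem_one_mul]

theorem vertexProj_ext {m n : X} (h0 : vertexProj Λ 0 m = vertexProj Λ 0 n)
    (h1 : vertexProj Λ 1 m = vertexProj Λ 1 n) : m = n := by
  rw [← coe_vertexProj_add (Λ := Λ) m, ← coe_vertexProj_add (Λ := Λ) n, h0, h1]

theorem vertexProj_map {Y : Type w} [AddCommGroup Y] [Module (TriangularRing Λ) Y] (i : Fin 2)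
    (φ : X →ₗ[TriangularRing Λ] Y) (m : X) :
    (vertexProj Λ i (φ m)).1 = φ (vertexProj Λ i m).1 :=
  (map_smul φ (vertexIdem Λ i) m).symm

/-- For generators `x` of `X`, the elements `e₁x` generate the first component. The second also
needs the images of the `e₁x` under the structure map, because of the lower left matrix entries. -/
theorem finite_component [Module.Finite (TriangularRing Λ) X] (i : Fin 2) :
    Module.Finite Λ (Component Λ X i) := by
  obtain ⟨s, hs⟩ := Module.Finite.fg_top (R := TriangularRing Λ) (M := X)
  match i with
  | 0 =>
    refine Module.finite_def.mpr (Submodule.fg_def.mpr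
      ⟨vertexProj Λ 0 '' (s : Set X), s.finite_toSet.image _, ?_⟩)
    refine eq_top_iff.mpr fun m _ => ?_
    have key : ∀ x : X, vertexProj Λ 0 x ∈ Submodule.span Λ (vertexProj Λ 0 '' (s : Set X)) := by
      intro x
      have hx : x ∈ Submodule.span (TriangularRing Λ) (s : Set X) := hs ▸ Submodule.mem_top
      induction hx using Submodule.span_induction with
      | mem y hy => exact Submodule.subset_span ⟨y, hy, rfl⟩
      | zero => rw [map_zero]; exact Submodule.zero_mem _
      | add y z _ _ h1 h2 => rw [map_add]; exact Submodule.add_mem _ h1 h2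
      | smul a y _ h =>
        rw [vertexProj_zero_smul]
        exact Submodule.smul_mem _ _ h
    rw [← vertexProj_coe 0 m]
    exact key m.1
  | 1 =>
    refine Module.finite_def.mpr (Submodule.fg_def.mpr
      ⟨(fun x => structureMap Λ X (vertexProj Λ 0 x)) '' (s : Set X) ∪
        vertexProj Λ 1 '' (s : Set X),
        (s.finite_toSet.image _).union (s.finite_toSet.image _), ?_⟩)
    refine eq_top_iff.mpr fun m _ => ?_
    set W := Submodule.span Λ ((fun x => structureMap Λ X (vertexProj Λ 0 x)) '' (s : Set X) ∪
        vertexProj Λ 1 '' (s : Set X)) with hW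
    -- The second component of `a • y` involves the structure map on the first component of `y`, so
    -- the induction carries both memberships.
    have key : ∀ x : X, structureMap Λ X (vertexProj Λ 0 x) ∈ W ∧ vertexProj Λ 1 x ∈ W := by
      intro x
      have hx : x ∈ Submodule.span (TriangularRing Λ) (s : Set X) := hs ▸ Submodule.mem_top
      induction hx using Submodule.span_induction with
      | mem y hy => exact ⟨Submodule.subset_span (Or.inl ⟨y, hy, rfl⟩),
          Submodule.subset_span (Or.inr ⟨y, hy, rfl⟩)⟩
      | zero => simp only [map_zero]; exact ⟨Submodule.zero_mem _, Submodule.zero_mem _⟩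
      | add y z _ _ h1 h2 =>
        simp only [map_add]
        exact ⟨Submodule.add_mem _ h1.1 h2.1, Submodule.add_mem _ h1.2 h2.2⟩
      | smul a y _ h =>
        rw [vertexProj_zero_smul, vertexProj_one_smul, map_smul]
        exact ⟨Submodule.smul_mem _ _ h.1,
          Submodule.add_mem _ (Submodule.smul_mem _ _ h.1) (Submodule.smul_mem _ _ h.2)⟩
    rw [← vertexProj_coe 1 m]
    exact (key m.1).2

end Modules

/-! ### From triples back to modules, and maps into and out of them. -/

section Triples

variable {Λ : Type u} [Ring Λ] {A B : Type v} [AddCommGroup A] [Module Λ A]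
  [AddCommGroup B] [Module Λ B]

/-- The module over the triangular matrix ring given by the triple `(A, B, f)`. -/
def Triple (_f : A →ₗ[Λ] B) : Type v := A × B

namespace Triple

variable (f : A →ₗ[Λ] B)

instance : AddCommGroup (Triple f) := inferInstanceAs (AddCommGroup (A × B))

instance : SMul (TriangularRing Λ) (Triple f) where
  smul x m := (x.1 0 0 • m.1, x.1 1 0 • f m.1 + x.1 1 1 • m.2)

variable {f}

theorem smul_fst (x : TriangularRing Λ) (m : Triple f) : (x • m).1 = x.1 0 0 • m.1 := rfl

theorem smul_snd (x : TriangularRing Λ) (m : Triple f) :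
    (x • m).2 = x.1 1 0 • f m.1 + x.1 1 1 • m.2 := rfl

theorem add_fst (m n : Triple f) : (m + n).1 = m.1 + n.1 := rfl

theorem add_snd (m n : Triple f) : (m + n).2 = m.2 + n.2 := rfl

theorem zero_fst : (0 : Triple f).1 = 0 := rfl

theorem zero_snd : (0 : Triple f).2 = 0 := rfl

instance : Module (TriangularRing Λ) (Triple f) where
  one_smul m := Prod.ext (by simp [smul_fst]) (by simp [smul_snd])
  mul_smul x y m := by
    have hx : x.1 0 1 = 0 := x.2
    refine Prod.ext ?_ ?_
    · simp [smul_fst, Matrix.mul_apply, hx, mul_smul]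
    · have hy : y.1 0 1 = 0 := y.2
      simp [smul_fst, smul_snd, Matrix.mul_apply, hy, mul_smul, add_smul, add_assoc]
  smul_zero x := Prod.ext (by simp [smul_fst, zero_fst]) (by simp [smul_snd, zero_fst, zero_snd])
  smul_add x m n := Prod.ext (by simp [smul_fst, add_fst]) (by
    simp only [smul_snd, add_fst, add_snd, map_add, smul_add]
    abel)
  add_smul x y m := Prod.ext (by simp [smul_fst, add_fst, add_smul]) (by
    simp only [smul_snd, add_snd, Subring.coe_add, Matrix.add_apply, add_smul]
    abel)
  zero_smul m := Prod.ext (by simp [smul_fst, zero_fst]) (by simp [smul_snd, zero_snd])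

variable (f)

/-- The inclusion of `A` as the first component of `(A, B, f)`. -/
def inFst : A →ₗ[Λ] Component Λ (Triple f) 0 where
  toFun a := ⟨((a, 0) : A × B), by
    refine Prod.ext ?_ ?_
    · change (vertexIdem Λ 0).1 0 0 • a = a
      simp [vertexIdem]
    · change (vertexIdem Λ 0).1 1 0 • f a + (vertexIdem Λ 0).1 1 1 • (0 : B) = 0
      simp [vertexIdem]⟩
  map_add' a b := Subtype.ext (Prod.ext rfl (add_zero 0).symm)
  map_smul' x a := Subtype.ext (Prod.ext
    (by
      change x • a = (scalarEmb Λ x).1 0 0 • a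
      simp [scalarEmb])
    (by
      change 0 = (scalarEmb Λ x).1 1 0 • f a + (scalarEmb Λ x).1 1 1 • (0 : B)
      simp [scalarEmb]))

/-- The inclusion of `B` as the second component of `(A, B, f)`. -/
def inSnd : B →ₗ[Λ] Component Λ (Triple f) 1 where
  toFun b := ⟨((0, b) : A × B), by
    refine Prod.ext ?_ ?_
    · change (vertexIdem Λ 1).1 0 0 • (0 : A) = 0
      simp
    · change (vertexIdem Λ 1).1 1 0 • f 0 + (vertexIdem Λ 1).1 1 1 • b = b
      simp [vertexIdem]⟩
  map_add' a b := Subtype.ext (Prod.ext (add_zero 0).symm rfl)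
  map_smul' x b := Subtype.ext (Prod.ext
    (by
      change 0 = (scalarEmb Λ x).1 0 0 • (0 : A)
      simp)
    (by
      change x • b = (scalarEmb Λ x).1 1 0 • f 0 + (scalarEmb Λ x).1 1 1 • b
      simp [scalarEmb]))

/-- The projection of the second component of `(A, B, f)` to `B`. -/
def outSnd : Component Λ (Triple f) 1 →ₗ[Λ] B where
  toFun m := m.1.2
  map_add' _ _ := rfl
  map_smul' x m := by
    change (scalarEmb Λ x).1 1 0 • f m.1.1 + (scalarEmb Λ x).1 1 1 • m.1.2 = x • m.1.2
    simp [scalarEmb]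

variable {f}

theorem component_zero_snd (m : Component Λ (Triple f) 0) : m.1.2 = 0 := by
  have h : (vertexIdem Λ 0 • m.1).2 = m.1.2 := congrArg Prod.snd m.2
  rw [← h]
  simp [smul_snd, vertexIdem]

theorem component_one_fst (m : Component Λ (Triple f) 1) : m.1.1 = 0 := by
  have h : (vertexIdem Λ 1 • m.1).1 = m.1.1 := congrArg Prod.fst m.2
  rw [← h]
  simp [smul_fst, vertexIdem]

theorem structureMap_inFst (a : A) :
    structureMap Λ (Triple f) (inFst f a) = inSnd f (f a) := by
  refine Subtype.ext (Prod.ext ?_ ?_)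
  · change (arrowElem Λ).1 0 0 • a = 0
    simp [arrowElem]
  · change (arrowElem Λ).1 1 0 • f a + (arrowElem Λ).1 1 1 • (0 : B) = f a
    simp [arrowElem]

instance [Module.Finite Λ A] [Module.Finite Λ B] :
    Module.Finite (TriangularRing Λ) (Triple f) := by
  obtain ⟨s, hs⟩ := Module.Finite.fg_top (R := Λ) (M := A)
  obtain ⟨t, ht⟩ := Module.Finite.fg_top (R := Λ) (M := B)
  refine Module.finite_def.mpr (Submodule.fg_def.mpr
    ⟨(fun a => (inFst f a).1) '' (s : Set A) ∪ (fun b => (inSnd f b).1) '' (t : Set B),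
      (s.finite_toSet.image _).union (t.finite_toSet.image _), ?_⟩)
  refine eq_top_iff.mpr fun m _ => ?_
  set W := Submodule.span (TriangularRing Λ)
    ((fun a => (inFst f a).1) '' (s : Set A) ∪ (fun b => (inSnd f b).1) '' (t : Set B)) with hW
  have hA : ∀ a : A, (inFst f a).1 ∈ W := by
    intro a
    have ha : a ∈ Submodule.span Λ (s : Set A) := hs ▸ Submodule.mem_top
    induction ha using Submodule.span_induction with
    | mem y hy => exact Submodule.subset_span (Or.inl ⟨y, hy, rfl⟩)
    | zero => rw [map_zero]; exact Submodule.zero_mem _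
    | add y z _ _ h1 h2 => rw [map_add]; exact Submodule.add_mem _ h1 h2
    | smul x y _ h => rw [map_smul]; exact Submodule.smul_mem _ (scalarEmb Λ x) h
  have hB : ∀ b : B, (inSnd f b).1 ∈ W := by
    intro b
    have hb : b ∈ Submodule.span Λ (t : Set B) := ht ▸ Submodule.mem_top
    induction hb using Submodule.span_induction with
    | mem y hy => exact Submodule.subset_span (Or.inr ⟨y, hy, rfl⟩)
    | zero => rw [map_zero]; exact Submodule.zero_mem _
    | add y z _ _ h1 h2 => rw [map_add]; exact Submodule.add_mem _ h1 h2
    | smul x y _ h => rw [map_smul]; exact Submodule.smul_mem _ (scalarEmb Λ x) h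
  have hm : m = (inFst f m.1).1 + (inSnd f m.2).1 :=
    Prod.ext (add_zero _).symm (zero_add _).symm
  rw [hm]
  exact Submodule.add_mem _ (hA _) (hB _)

variable {X : Type w} [AddCommGroup X] [Module (TriangularRing Λ) X]

/-- A pair of maps commuting with the structure maps, as a map out of `(A, B, f)`. -/
def lift (a : A →ₗ[Λ] Component Λ X 0) (b : B →ₗ[Λ] Component Λ X 1)
    (h : ∀ x, structureMap Λ X (a x) = b (f x)) : Triple f →ₗ[TriangularRing Λ] X where
  toFun m := (a m.1).1 + (b m.2).1
  map_add' m n := by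
    have h1 : (a (m.1 + n.1)).1 = (a m.1).1 + (a n.1).1 := by rw [map_add]; rfl
    have h2 : (b (m.2 + n.2)).1 = (b m.2).1 + (b n.2).1 := by rw [map_add]; rfl
    change (a (m.1 + n.1)).1 + (b (m.2 + n.2)).1 = _
    rw [h1, h2]
    abel
  map_smul' x m := by
    refine vertexProj_ext (Λ := Λ) ?_ ?_
    · rw [vertexProj_zero_add, RingHom.id_apply, vertexProj_zero_smul, vertexProj_zero_add, smul_fst, map_smul]
    · rw [vertexProj_one_add, RingHom.id_apply, vertexProj_one_smul, vertexProj_zero_add,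
        vertexProj_one_add, smul_snd, map_add, map_smul, map_smul, h]

/-- A pair of maps commuting with the structure maps, as a map to `(A, B, f)`. -/
def corestrict (a : Component Λ X 0 →ₗ[Λ] A) (b : Component Λ X 1 →ₗ[Λ] B)
    (h : ∀ x, f (a x) = b (structureMap Λ X x)) : X →ₗ[TriangularRing Λ] Triple f where
  toFun m := ((a (vertexProj Λ 0 m), b (vertexProj Λ 1 m)) : A × B)
  map_add' m n := Prod.ext
    (by
      change a (vertexProj Λ 0 (m + n)) = a (vertexProj Λ 0 m) + a (vertexProj Λ 0 n)
      rw [map_add, map_add])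
    (by
      change b (vertexProj Λ 1 (m + n)) = b (vertexProj Λ 1 m) + b (vertexProj Λ 1 n)
      rw [map_add, map_add])
  map_smul' x m := Prod.ext
    (by
      change a (vertexProj Λ 0 (x • m)) = x.1 0 0 • a (vertexProj Λ 0 m)
      rw [vertexProj_zero_smul, map_smul])
    (by
      change b (vertexProj Λ 1 (x • m)) =
        x.1 1 0 • f (a (vertexProj Λ 0 m)) + x.1 1 1 • b (vertexProj Λ 1 m)
      rw [vertexProj_one_smul, map_add, map_smul, map_smul, h])

theorem lift_inFst (a : A →ₗ[Λ] Component Λ X 0) (b : B →ₗ[Λ] Component Λ X 1)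
    (h : ∀ x, structureMap Λ X (a x) = b (f x)) (x : A) :
    lift a b h (inFst f x).1 = (a x).1 := by
  change (a x).1 + (b 0).1 = (a x).1
  rw [map_zero]
  exact add_zero _

theorem lift_inSnd (a : A →ₗ[Λ] Component Λ X 0) (b : B →ₗ[Λ] Component Λ X 1)
    (h : ∀ x, structureMap Λ X (a x) = b (f x)) (y : B) :
    lift a b h (inSnd f y).1 = (b y).1 := by
  change (a 0).1 + (b y).1 = (b y).1
  rw [map_zero]
  exact zero_add _

end Triple

end Triples

/-! ### Generalities on split maps. -/

section Sequences

variable {S : Type u} [Ring S] {A B C : Type v} [AddCommGroup A] [Module S A] [AddCommGroup B]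
  [Module S B] [AddCommGroup C] [Module S C]

/-- The splitting lemma; it converts the retraction of `j₃` into a section of `p₃`. -/
theorem IsShortExact.isSplittableEpi_of_mono {j : A →ₗ[S] B} {p : B →ₗ[S] C}
    (h : IsShortExact j p) (hj : IsSplittableMono j) : IsSplittableEpi p := by
  have := (h.exact.split_tfae (f := j) (g := p) h.injective h.surjective).out 1 0
  exact this.mp hj

theorem isSplittableEpi_surjective {p : B →ₗ[S] C} (h : IsSplittableEpi p) :
    Function.Surjective p := by
  obtain ⟨s, hs⟩ := h
  exact fun c => ⟨s c, LinearMap.congr_fun hs c⟩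

theorem isSplittableMono_injective {j : A →ₗ[S] B} (h : IsSplittableMono j) :
    Function.Injective j := by
  obtain ⟨r, hr⟩ := h
  exact Function.LeftInverse.injective (g := r) fun c => LinearMap.congr_fun hr c

end Sequences

/-! ### Exactness of the induced sequences. -/

section Exactness

variable {Λ : Type u} [Ring Λ] {N E M : Type v} [AddCommGroup N] [Module (TriangularRing Λ) N]
  [AddCommGroup E] [Module (TriangularRing Λ) E] [AddCommGroup M] [Module (TriangularRing Λ) M]
  {j : N →ₗ[TriangularRing Λ] E} {p : E →ₗ[TriangularRing Λ] M}

/-- Any preimage can be moved into the component by multiplying it by the idempotent, which commutes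
with module maps. -/
theorem IsShortExact.componentMap (h : IsShortExact j p) (i : Fin 2) :
    IsShortExact (componentMap Λ j i) (componentMap Λ p i) where
  injective x y hxy := Subtype.ext (h.injective (congrArg Subtype.val hxy))
  exact y := by
    constructor
    · intro hy
      obtain ⟨x, hx⟩ := (h.exact y.1).mp (congrArg Subtype.val hy)
      refine ⟨vertexProj Λ i x, Subtype.ext ?_⟩
      change j (vertexProj Λ i x).1 = y.1
      rw [← vertexProj_map, hx, vertexProj_coe]
    · rintro ⟨x, rfl⟩
      exact Subtype.ext ((h.exact _).mpr ⟨x.1, rfl⟩)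
  surjective z := by
    obtain ⟨y, hy⟩ := h.surjective z.1
    refine ⟨vertexProj Λ i y, Subtype.ext ?_⟩
    change p (vertexProj Λ i y).1 = z.1
    rw [← vertexProj_map, hy, vertexProj_coe]

/-- The left exact half of the snake lemma: a preimage in `N₁` of an element of `ker h` lies in `ker
g` because `j₂` is injective. -/
theorem IsShortExact.kernelMap (h : IsShortExact j p)
    (hp : Function.Surjective (kernelMap Λ p)) :
    IsShortExact (kernelMap Λ j) (kernelMap Λ p) where
  injective x y hxy :=
    Subtype.ext ((h.componentMap 0).injective (congrArg Subtype.val hxy))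
  exact y := by
    constructor
    · intro hy
      obtain ⟨x, hx⟩ := ((h.componentMap 0).exact y.1).mp (congrArg Subtype.val hy)
      refine ⟨⟨x, ?_⟩, Subtype.ext hx⟩
      rw [LinearMap.mem_ker]
      apply (h.componentMap 1).injective
      have := LinearMap.congr_fun (structureMap_comp_componentMap Λ j) x
      simp only [LinearMap.comp_apply] at this
      rw [← this, hx, map_zero]
      exact y.2
    · rintro ⟨x, rfl⟩
      exact Subtype.ext (((h.componentMap 0).exact _).mpr ⟨x.1, rfl⟩)
  surjective := hp

theorem IsShortExact.cokernelMap (h : IsShortExact j p)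
    (hj : Function.Injective (cokernelMap Λ j)) :
    IsShortExact (cokernelMap Λ j) (cokernelMap Λ p) where
  injective := hj
  exact y := by
    constructor
    · obtain ⟨y, rfl⟩ := Submodule.Quotient.mk_surjective _ y
      intro hy
      obtain ⟨m, hm⟩ := (Submodule.Quotient.mk_eq_zero _).mp hy
      obtain ⟨e, rfl⟩ := (h.componentMap 0).surjective m
      have hc := LinearMap.congr_fun (structureMap_comp_componentMap Λ p) e
      simp only [LinearMap.comp_apply] at hc
      -- Correcting `y` by `h e` leaves its class in the cokernel unchanged and puts it in the
      -- kernel of `p₂`.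
      obtain ⟨n, hn⟩ := ((h.componentMap 1).exact (y - structureMap Λ E e)).mp (by
        rw [map_sub, sub_eq_zero, ← hc, hm])
      refine ⟨Submodule.Quotient.mk n, ?_⟩
      change Submodule.Quotient.mk (ARTri.componentMap Λ j 1 n) = _
      rw [hn, Submodule.Quotient.eq]
      exact ⟨-e, by rw [map_neg]; abel⟩
    · rintro ⟨x, rfl⟩
      obtain ⟨x, rfl⟩ := Submodule.Quotient.mk_surjective _ x
      change Submodule.Quotient.mk
        (ARTri.componentMap Λ p 1 (ARTri.componentMap Λ j 1 x)) = _
      rw [((h.componentMap 1).exact _).mpr ⟨x, rfl⟩]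
      rfl
  surjective z := by
    obtain ⟨z, rfl⟩ := Submodule.Quotient.mk_surjective _ z
    obtain ⟨y, rfl⟩ := (h.componentMap 1).surjective z
    exact ⟨Submodule.Quotient.mk y, rfl⟩

end Exactness

/-! ### The four test triples and the splittings they produce. -/

section Splittings

variable {Λ : Type u} [Ring Λ] {N E M : Type (max u v)}
  [AddCommGroup N] [Module (TriangularRing Λ) N]
  [AddCommGroup E] [Module (TriangularRing Λ) E] [AddCommGroup M] [Module (TriangularRing Λ) M]
  {j : N →ₗ[TriangularRing Λ] E} {p : E →ₗ[TriangularRing Λ] M}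

/-- A map out of `(M₁, M₁, id)` is determined by its first component, so `(id, f)` tests exactly for
a section of `p₁`. -/
theorem IsRightAlmostSplit.splittableEpi_fst [Module.Finite (TriangularRing Λ) M]
    (hp : IsRightAlmostSplit p) (hf : ¬ IsSplittableEpi (structureMap Λ M)) :
    IsSplittableEpi (componentMap Λ p 0) := by
  have := finite_component (Λ := Λ) (X := M) 0
  let q : Triple (LinearMap.id : Component Λ M 0 →ₗ[Λ] Component Λ M 0)
      →ₗ[TriangularRing Λ] M := Triple.lift LinearMap.id (structureMap Λ M) fun _ => rfl
  obtain ⟨t, ht⟩ := hp.factors _ q (by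
    rintro ⟨s, hs⟩
    -- On second components `q` is `f` itself, so the second component of `s` is a section of `f`.
    refine hf ⟨Triple.outSnd _ ∘ₗ componentMap Λ s 1, LinearMap.ext fun m => Subtype.ext ?_⟩
    have h1 : q (s m.1) = m.1 := LinearMap.congr_fun hs m.1
    have h2 : s m.1 = (Triple.inSnd _ (s m.1).2).1 :=
      Prod.ext (Triple.component_one_fst (componentMap Λ s 1 m)) rfl
    rw [h2] at h1
    exact (Triple.lift_inSnd _ (structureMap Λ M) (fun _ => rfl) (s m.1).2).symm.trans h1)
  refine ⟨componentMap Λ t 0 ∘ₗ Triple.inFst _, LinearMap.ext fun m => Subtype.ext ?_⟩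
  exact (LinearMap.congr_fun ht (Triple.inFst _ m).1).trans (Triple.lift_inFst _ _ _ _)

theorem IsRightAlmostSplit.splittableEpi_snd [Module.Finite (TriangularRing Λ) M]
    (hp : IsRightAlmostSplit p) (hf : ¬ IsSplittableMono (structureMap Λ M)) :
    IsSplittableEpi (componentMap Λ p 1) := by
  have := finite_component (Λ := Λ) (X := M) 1
  let q : Triple (0 : PUnit.{(max u v) + 1} →ₗ[Λ] Component Λ M 1)
      →ₗ[TriangularRing Λ] M := Triple.lift 0 LinearMap.id fun _ => map_zero _
  obtain ⟨t, ht⟩ := hp.factors _ q (by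
    rintro ⟨s, hs⟩
    -- A section of `q` sends `M₁` into a zero component, so `M₁ = 0` and the zero map is a left
    -- inverse of `f`.
    refine hf ⟨0, LinearMap.ext fun m => Subtype.ext ?_⟩
    have h1 : q (s m.1) = m.1 := LinearMap.congr_fun hs m.1
    have h2 : s m.1 = 0 :=
      Prod.ext (Subsingleton.elim _ _) (Triple.component_zero_snd (componentMap Λ s 0 m))
    rw [h2, map_zero] at h1
    exact h1)
  refine ⟨componentMap Λ t 1 ∘ₗ Triple.inSnd _, LinearMap.ext fun m => Subtype.ext ?_⟩
  exact (LinearMap.congr_fun ht (Triple.inSnd _ m).1).trans (Triple.lift_inSnd _ _ _ _)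

theorem IsRightAlmostSplit.splittableEpi_kernel [IsNoetherianRing Λ]
    [Module.Finite (TriangularRing Λ) M]
    (hp : IsRightAlmostSplit p) (hf : ¬ IsSplittableEpi (structureMap Λ M)) :
    IsSplittableEpi (kernelMap Λ p) := by
  have := finite_component (Λ := Λ) (X := M) 0
  let q : Triple (0 : LinearMap.ker (structureMap Λ M) →ₗ[Λ] PUnit.{(max u v) + 1})
      →ₗ[TriangularRing Λ] M := Triple.lift (Submodule.subtype _) 0 fun x => x.2
  obtain ⟨t, ht⟩ := hp.factors _ q (by
    rintro ⟨s, hs⟩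
    -- Here the section kills `M₂`, so `M₂ = 0` and the zero map is a right inverse of `f`.
    refine hf ⟨0, LinearMap.ext fun m => Subtype.ext ?_⟩
    have h1 : q (s m.1) = m.1 := LinearMap.congr_fun hs m.1
    have h2 : s m.1 = 0 :=
      Prod.ext (Triple.component_one_fst (componentMap Λ s 1 m)) (Subsingleton.elim _ _)
    rw [h2, map_zero] at h1
    rw [LinearMap.comp_zero]
    exact h1)
  refine ⟨LinearMap.codRestrict _ (componentMap Λ t 0 ∘ₗ Triple.inFst _) fun m => ?_,
    LinearMap.ext fun m => Subtype.ext (Subtype.ext ?_)⟩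
  -- The zero structure map of the test triple makes the first component of `t` land in `ker h`.
  · have hc := LinearMap.congr_fun (structureMap_comp_componentMap Λ t) (Triple.inFst _ m)
    simp only [LinearMap.comp_apply] at hc
    rw [LinearMap.mem_ker, LinearMap.comp_apply, hc, Triple.structureMap_inFst,
      LinearMap.zero_apply, map_zero, map_zero]
  · exact (LinearMap.congr_fun ht (Triple.inFst _ m).1).trans (Triple.lift_inFst _ _ _ _)

/-- Dual to the kernel case, with the test map `N → (0, coker g, 0)`. -/
theorem IsLeftAlmostSplit.splittableMono_cokernel [Module.Finite (TriangularRing Λ) N]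
    (hj : IsLeftAlmostSplit j) (hg : ¬ IsSplittableMono (structureMap Λ N)) :
    IsSplittableMono (cokernelMap Λ j) := by
  have := finite_component (Λ := Λ) (X := N) 1
  let f : PUnit.{(max u v) + 1} →ₗ[Λ]
    (Component Λ N 1 ⧸ LinearMap.range (structureMap Λ N)) := 0
  let q : N →ₗ[TriangularRing Λ] Triple f :=
    Triple.corestrict 0 (Submodule.mkQ _) fun x =>
      ((Submodule.Quotient.mk_eq_zero _).mpr (LinearMap.mem_range_self _ x)).symm
  obtain ⟨t, ht⟩ := hj.factors _ q (by
    rintro ⟨r, hr⟩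
    refine hg ⟨0, LinearMap.ext fun n => Subtype.ext ?_⟩
    have h1 : r (q n.1) = n.1 := LinearMap.congr_fun hr n.1
    have h2 : q n.1 = 0 :=
      Prod.ext (Subsingleton.elim _ _) (Triple.component_zero_snd (componentMap Λ q 0 n))
    rw [h2, map_zero] at h1
    exact h1)
  refine ⟨Submodule.liftQ _ (Triple.outSnd f ∘ₗ componentMap Λ t 1) ?_, ?_⟩
  · rintro _ ⟨e, rfl⟩
    have hc := LinearMap.congr_fun (structureMap_comp_componentMap Λ t) e
    simp only [LinearMap.comp_apply] at hc
    -- The first component of the target is zero, so the second component of `t` kills the image of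
    -- `h` and descends to `coker h`.
    have h0 : componentMap Λ t 0 e = 0 :=
      Subtype.ext (Prod.ext (Subsingleton.elim _ _) (Triple.component_zero_snd _))
    rw [LinearMap.mem_ker, LinearMap.comp_apply, ← hc, h0, map_zero, map_zero]
  · refine Submodule.linearMap_qext _ (LinearMap.ext fun n => ?_)
    have h1 : t (j n.1) = q n.1 := LinearMap.congr_fun ht n.1
    have h2 : (q n.1).2 = Submodule.Quotient.mk n := by
      change Submodule.Quotient.mk (vertexProj Λ 1 n.1) = _
      rw [vertexProj_coe]
    exact (congrArg Prod.snd h1).trans h2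

end Splittings

end ARTri

theorem mainTheorem3 {R : Type w} [CommRing R] [IsArtinianRing R]
    {Λ : Type u} [Ring Λ] [Algebra R Λ] [Module.Finite R Λ]
    {N E M : Type (max u v)}
    [AddCommGroup N] [Module (ARTri.TriangularRing Λ) N]
    [AddCommGroup E] [Module (ARTri.TriangularRing Λ) E]
    [AddCommGroup M] [Module (ARTri.TriangularRing Λ) M]
    (j : N →ₗ[ARTri.TriangularRing Λ] E) (p : E →ₗ[ARTri.TriangularRing Λ] M)
    (hjp : ARTri.IsAlmostSplitSequence j p)
    (hg_epi : ¬ ARTri.IsSplittableEpi (ARTri.structureMap Λ N))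
    (hg_mono : ¬ ARTri.IsSplittableMono (ARTri.structureMap Λ N))
    (hf_epi : ¬ ARTri.IsSplittableEpi (ARTri.structureMap Λ M))
    (hf_mono : ¬ ARTri.IsSplittableMono (ARTri.structureMap Λ M)) :
    Function.Surjective (ARTri.kernelMap Λ p) ∧
    Function.Injective (ARTri.cokernelMap Λ j) ∧
    ARTri.IsSplitShortExact (ARTri.kernelMap Λ j) (ARTri.kernelMap Λ p) ∧
    ARTri.IsSplitShortExact (ARTri.componentMap Λ j 0) (ARTri.componentMap Λ p 0) ∧
    ARTri.IsSplitShortExact (ARTri.componentMap Λ j 1) (ARTri.componentMap Λ p 1) ∧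
    ARTri.IsSplitShortExact (ARTri.cokernelMap Λ j) (ARTri.cokernelMap Λ p) ∧
    ARTri.IsRelativelyExact Λ j p := by
  -- An artinian `R` is noetherian, and `Λ` is a finite `R`-module.
  have : IsNoetherianRing Λ := by
    have : IsNoetherian R Λ := inferInstance
    exact isNoetherian_of_tower R this
  have := hjp.finite_left
  have := hjp.finite_right
  have h := hjp.toIsShortExact
  have k := hjp.right_almost_split.splittableEpi_kernel hf_epi
  have c := hjp.left_almost_split.splittableMono_cokernel hg_mono
  have k_surj := ARTri.isSplittableEpi_surjective k
  have c_inj := ARTri.isSplittableMono_injective c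
  have s0 : ARTri.IsSplitShortExact (ARTri.kernelMap Λ j) (ARTri.kernelMap Λ p) :=
    ⟨h.kernelMap k_surj, k⟩
  have s1 : ARTri.IsSplitShortExact (ARTri.componentMap Λ j 0) (ARTri.componentMap Λ p 0) :=
    ⟨h.componentMap 0, hjp.right_almost_split.splittableEpi_fst hf_epi⟩
  have s2 : ARTri.IsSplitShortExact (ARTri.componentMap Λ j 1) (ARTri.componentMap Λ p 1) :=
    ⟨h.componentMap 1, hjp.right_almost_split.splittableEpi_snd hf_mono⟩
  exact ⟨k_surj, c_inj, s0, s1, s2,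
    ⟨h.cokernelMap c_inj, (h.cokernelMap c_inj).isSplittableEpi_of_mono c⟩, h, s0, s1, s2⟩
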